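/- Let $\mathbb k$ be a field of characteristic $0$, let $\mathfrak g$ be a finite-dimensional reductive Lie algebra over $\mathbb k$ (i.e. the radical of $\mathfrak g$ equals its centre), let $e\in\mathfrak g$ satisfy $(\mathrm{ad}\,e)^3=0$, and put $D=(\mathrm{ad}\,e)^2\in\mathrm{End}(\mathfrak g)$. Let $$[x,y]'_D=D([x,y])-[Dx,y]-[x,Dy]\qquad(x,y\in\mathfrak g)$$ be the derived operation of the bracket of $\mathfrak g$ with respect to $D$. Then $[\ ,\,]'_D$ is a Lie bracket on the vector space $\mathfrak g$, and the Lie algebra $\mathfrak g_D=(\mathfrak g,[\ ,\,]'_D)$ satisfies $$\mathrm{ind}\,\mathfrak g_D=\dim\mathfrak g^e,\qquad \mathfrak z(\mathfrak g_D)=\mathfrak g^e,\qquad\text{and hence}\qquad \dim\mathfrak z(\mathfrak g_D)=\mathrm{ind}\,\mathfrak g_D .$$ Here $\mathfrak g^e=\{x\in\mathfrak g\mid [x,e]=0\}$ is the centraliser of $e$ in $\mathfrak g$, $\mathfrak z(\mathfrak g_D)$ is the centre of $\mathfrak g_D$, and the index of a finite-dimensional Lie algebra $\mathfrak q$ is $\mathrm{ind}\,\mathfrak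 q=\min_{\xi\in\mathfrak q^*}\dim\mathfrak q^\xi$, where $\mathfrak q^\xi=\{x\in\mathfrak q\mid \xi([x,y])=0\text{ for all }y\in\mathfrak q\}$ is the stabiliser of $\xi$ in the coadjoint representation. -/

import Mathlib

namespace DerivedLie

section Index

variable (k : Type*) (q : Type*) [Field k] [LieRing q] [LieAlgebra k q]

/-- The centraliser of an element `e` in the Lie algebra `q`. -/
def centraliser (e : q) : Submodule k q where
  carrier := {x | ⁅x, e⁆ = 0}
  add_mem' {x y} hx hy := by
    have hx' : ⁅x, e⁆ = 0 := hx
    have hy' : ⁅y, e⁆ = 0 := hy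
    simp [hx', hy']
  zero_mem' := by simp
  smul_mem' c x hx := by
    have hx' : ⁅x, e⁆ = 0 := hx
    simp [hx']

/-- The stabiliser of `ξ` with respect to the coadjoint representation of `q` on its dual space
(the bracket `⁅x, ξ⁆` is the coadjoint action `y ↦ -ξ ⁅x, y⁆`). -/
def coadjointStabiliser (ξ : Module.Dual k q) : Submodule k q where
  carrier := {x | ⁅x, ξ⁆ = 0}
  add_mem' {x y} hx hy := by
    have hx' : ⁅x, ξ⁆ = 0 := hx
    have hy' : ⁅y, ξ⁆ = 0 := hy
    simp [hx', hy']
  zero_mem' := by simp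
  smul_mem' c x hx := by
    have hx' : ⁅x, ξ⁆ = 0 := hx
    simp [hx']

/-- The index of a finite-dimensional Lie algebra: the minimal dimension of the stabiliser of a
linear form with respect to the coadjoint representation. -/
noncomputable def index : ℕ :=
  ⨅ ξ : Module.Dual k q, Module.finrank k (coadjointStabiliser k q ξ)

end Index

section Bracket

variable {k : Type*} {V : Type*} [Field k] [AddCommGroup V] [Module k V]

/-- The derived operation `ψ'_D(x, y) = D (ψ(x, y)) - ψ(D x, y) - ψ(x, D y)` of a bilinear
operation `ψ` with respect to a linear operator `D`. -/
def derivedOperation (ψ : V →ₗ[k] V →ₗ[k] V) (D : Module.End k V) : V →ₗ[k] V →ₗ[k] V :=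
  LinearMap.mk₂ k (fun x y => D (ψ x y) - ψ (D x) y - ψ x (D y))
    (fun x x' y => by simp only [map_add, LinearMap.add_apply]; abel)
    (fun c x y => by simp only [map_smul, LinearMap.smul_apply, smul_sub])
    (fun x y y' => by simp only [map_add]; abel)
    (fun c x y => by simp only [map_smul, smul_sub])

/-- A bilinear operation is a Lie bracket if it is alternating and satisfies the Jacobi identity. -/
structure IsLieBracket (ψ : V →ₗ[k] V →ₗ[k] V) : Prop where
  alternating : ∀ x, ψ x x = 0
  jacobi : ∀ x y z, ψ x (ψ y z) + ψ y (ψ z x) + ψ z (ψ x y) = 0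

/-- The vector space `V` (as a type synonym), to be equipped with the Lie bracket `ψ`. -/
def WithBracket {ψ : V →ₗ[k] V →ₗ[k] V} (_h : IsLieBracket ψ) : Type _ := V

namespace WithBracket

variable {ψ : V →ₗ[k] V →ₗ[k] V} (h : IsLieBracket ψ)

instance : AddCommGroup (WithBracket h) := inferInstanceAs (AddCommGroup V)

instance : Module k (WithBracket h) := inferInstanceAs (Module k V)

/-- The identity map from `V` to the Lie algebra `(V, ψ)`. -/
def of : V ≃ₗ[k] WithBracket h := LinearEquiv.refl k V

/-- The Lie ring structure on `(V, ψ)`: the bracket is `ψ`. -/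
instance : LieRing (WithBracket h) where
  bracket x y := of h (ψ ((of h).symm x) ((of h).symm y))
  add_lie x y z := by
    change of h _ = of h _ + of h _
    simp
  lie_add x y z := by
    change of h _ = of h _ + of h _
    simp
  lie_self x := by
    change of h _ = 0
    simp [h.alternating]
  leibniz_lie x y z := by
    have hs : ∀ a b, ψ a b = -ψ b a := fun a b => by
      have := h.alternating (a + b)
      simp only [map_add, LinearMap.add_apply, h.alternating, zero_add, add_zero] at this
      exact eq_neg_of_add_eq_zero_right this
    change of h (ψ _ (ψ _ _)) = of h (ψ (ψ _ _) _) + of h (ψ _ (ψ _ _))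
    rw [← map_add]
    congr 1
    generalize (of h).symm x = a
    generalize (of h).symm y = b
    generalize (of h).symm z = c
    have hj := h.jacobi a b c
    rw [hs c a, map_neg, hs c (ψ a b)] at hj
    rw [← sub_eq_zero, ← hj]
    abel

instance : LieAlgebra k (WithBracket h) where
  lie_smul c x y := by
    change of h _ = c • of h _
    simp

theorem lie_of (x y : V) : ⁅of h x, of h y⁆ = of h (ψ x y) := rfl

end WithBracket

end Bracket

/-- The bracket of a Lie algebra as a bilinear operation. -/
def bracketMap (k : Type*) (g : Type*) [Field k] [LieRing g] [LieAlgebra k g] :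
    g →ₗ[k] g →ₗ[k] g :=
  LinearMap.mk₂ k (fun x y => ⁅x, y⁆) add_lie smul_lie lie_add lie_smul

end DerivedLie

/-!
Write `a = ad e`.  Expanding `a² ⁅x, y⁆` by the Leibniz rule shows that the derived bracket is
`2 ⁅a x, a y⁆`, and `a³ ⁅y, z⁆ = 0` gives `a ⁅a y, a z⁆ = 0`.  Hence the derived bracket of three
elements vanishes: it is a (two-step nilpotent) Lie bracket, and its centre contains `g^e`.

The centre lies in the stabiliser of every linear form, so everything follows once a single linear
form `ξ` is found whose stabiliser is contained in `g^e`: then `g^e`, the centre and the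
stabiliser of `ξ` coincide, and no stabiliser is smaller.

By Cartan's criterion the kernel of the Killing form `κ` of a reductive Lie algebra is contained in
the centre.  As `tr (a ∘ ad z) = 0` whenever `a` commutes with `[a, ad z]`
(`isNilpotent_mul_of_commute_commutator`), the element `e` is orthogonal to all `z` with
`a² z` central; by duality `e` is congruent to an element of the image of `a²` modulo the centre
(`exists_sub_lie_lie_mem_center`).  This yields `f` such that `a`, `b = -2 ad f` and
`h = [a, b]` satisfy `[h, a] = 2 a`: a weak form of the Jacobson–Morozov theorem, in
which the relation `[h, b] = -2 b` is not needed.  Take `ξ = κ(f, ·)`.  If `x` stabilises `ξ`, then invariance of `κ`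
makes `a b a x` central, and an `sl₂`-type calculation
(`apply_eq_zero_of_commutator_eq_two_smul`) forces `a x = 0`.
-/

namespace DerivedLie

/-! ### Commutator identities for an element of cube zero -/

section Ring

variable {A : Type*} [Ring A] {a b c : A}

/-- If `a³ = 0` and `a` commutes with `c = [a, b]`, then `c` is nilpotent; this is an explicit form
of a theorem of Jacobson. -/
theorem mul_commutator_pow_eq_zero (h2 : ∀ x : A, 2 * x = 0 → x = 0)
    (h3 : ∀ x : A, 3 * x = 0 → x = 0) (ha : a * a * a = 0) (hc : a * b - b * a - c = 0)
    (hac : a * c - c * a = 0) : a * c ^ 3 = 0 ∧ c ^ 7 = 0 := by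
  have haac : a * a * c = 0 := by
    apply h3
    calc 3 * (a * a * c) = a * a * a * b - b * (a * a * a) - (a * b - b * a - c) * a * a
          - a * (a * b - b * a - c) * a - a * a * (a * b - b * a - c)
          + (a * c - c * a) * a + 2 * (a * (a * c - c * a)) := by noncomm_ring
      _ = 0 := by rw [ha, hc, hac]; simp
  have hcaa : c * a * a = 0 := by
    calc c * a * a = a * a * c - a * (a * c - c * a) - (a * c - c * a) * a := by noncomm_ring
      _ = 0 := by rw [haac, hac]; simp
  have hac3 : a * c ^ 3 = 0 := by
    apply h2
    -- Multiply `[a² c, b] = 0` on the left by `c`.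
    calc 2 * (a * c ^ 3) = c * (a * a * c) * b - c * b * (a * a * c)
          - c * a * a * (c * b - b * c)
          - c * (a * (a * b - b * a - c) + (a * b - b * a - c) * a) * c
          + 2 * ((a * c - c * a) * c * c) + c * (a * c - c * a) * c := by noncomm_ring
      _ = 0 := by rw [haac, hcaa, hc, hac]; simp
  have hc3a : c ^ 3 * a = 0 := by
    calc c ^ 3 * a = a * c ^ 3 - (a * c - c * a) * c ^ 2 - c * (a * c - c * a) * c
          - c ^ 2 * (a * c - c * a) := by noncomm_ring
      _ = 0 := by rw [hac3, hac]; simp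
  refine ⟨hac3, ?_⟩
  -- Multiply `[a c³, b] = 0` on the left by `c³`.
  calc c ^ 7 = c ^ 3 * (a * c ^ 3) * b - c ^ 3 * b * (a * c ^ 3)
        - c ^ 3 * (a * b - b * a - c) * c ^ 3 - c ^ 3 * a * (c ^ 3 * b - b * c ^ 3) := by
        noncomm_ring
    _ = 0 := by rw [hac3, hc3a, hc]; simp

/-- If `a³ = 0` and `a` commutes with `[a, b]`, then `a b` is nilpotent. Right multiplication by
`a b` is triangular on the left ideals `A ⊇ A a ⊇ A a²`, with diagonal entries `c`, `2 c` and `0`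
for the nilpotent element `c = [a, b]`. -/
theorem isNilpotent_mul_of_commute_commutator (h2 : ∀ x : A, 2 * x = 0 → x = 0)
    (h3 : ∀ x : A, 3 * x = 0 → x = 0) (ha : a * a * a = 0) (hc : a * b - b * a - c = 0)
    (hac : a * c - c * a = 0) : IsNilpotent (a * b) := by
  obtain ⟨hac3, hc7⟩ := mul_commutator_pow_eq_zero h2 h3 ha hc hac
  have hab : a * b = c + b * a := by
    rw [← sub_eq_zero, ← hc]; abel
  have hcomm : Commute a c := sub_eq_zero.mp hac
  have haab : a * (a * b) = 2 * (c * a) + b * a * a := by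
    rw [hab, mul_add, hcomm.eq, ← mul_assoc, hab]; noncomm_ring
  have hzero : ∀ n, ∃ r, (a * b) ^ n = c ^ n + r * a := by
    intro n
    induction n with
    | zero => exact ⟨0, by simp⟩
    | succ n ih =>
      obtain ⟨r, hr⟩ := ih
      refine ⟨c ^ n * b + r * (2 * c + b * a), ?_⟩
      rw [pow_succ, hr, add_mul, mul_assoc r, haab, hab]
      noncomm_ring
  have hone : ∀ n, ∃ r, a * (a * b) ^ n = 2 ^ n * c ^ n * a + r * (a * a) := by
    intro n
    induction n with
    | zero => exact ⟨0, by simp⟩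
    | succ n ih =>
      obtain ⟨r, hr⟩ := ih
      have hcube : a * a * (a * b) = 0 := by rw [← mul_assoc, ha, zero_mul]
      refine ⟨2 ^ n * c ^ n * b, ?_⟩
      have h2c : Commute (2 : A) (c ^ n) := Nat.cast_ofNat (R := A) (n := 2) ▸ Nat.cast_commute 2 (c ^ n)
      rw [pow_succ, ← mul_assoc, hr, add_mul, mul_assoc r, hcube, mul_zero, add_zero,
        mul_assoc _ a, haab, mul_add, ← mul_assoc _ (2 : A), mul_assoc _ _ (2 : A), ← h2c.eq,
        pow_succ, pow_succ]
      noncomm_ring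
  obtain ⟨r, hr⟩ := hzero 7
  obtain ⟨s, hs⟩ := hone 3
  have hfour : a * (a * b) ^ 4 = 0 := by
    have hc3a : c ^ 3 * a = 0 := by rw [← (hcomm.pow_right 3).eq, hac3]
    rw [pow_succ, ← mul_assoc, hs, mul_assoc _ _ a, hc3a, mul_zero, zero_add, mul_assoc,
      ← mul_assoc (a * a), ha, zero_mul, mul_zero]
  exact ⟨7 + 4, by rw [pow_add, hr, hc7, zero_add, mul_assoc, hfour, mul_zero]⟩

/-- In a representation of the relations `a³ = 0`, `h = [a, b]`, `[h, a] = 2 a` of `sl₂`: vector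
`a b a x` is killed by both `a` and `h` only if `a x = 0`. -/
theorem apply_eq_zero_of_commutator_eq_two_smul {k V : Type*} [Field k] [CharZero k]
    [AddCommGroup V] [Module k V] {a b h : Module.End k V} (ha : a * a * a = 0)
    (hab : a * b - b * a - h = 0) (hha : h * a - a * h - (2 : k) • a = 0) {x : V}
    (hax : a (a (b (a x))) = 0) (hhx : h (a (b (a x))) = 0) : a x = 0 := by
  have hcube (v : V) : a (a (a v)) = 0 := by simpa using LinearMap.congr_fun ha v
  have hab' (v : V) : a (b v) = b (a v) + h v := by
    have := LinearMap.congr_fun hab v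
    simp only [LinearMap.sub_apply, Module.End.mul_apply, LinearMap.zero_apply] at this
    rwa [sub_sub, sub_eq_zero] at this
  have hha' (v : V) : h (a v) = a (h v) + (2 : k) • a v := by
    have := LinearMap.congr_fun hha v
    simp only [LinearMap.sub_apply, Module.End.mul_apply, LinearMap.zero_apply,
      LinearMap.smul_apply] at this
    rwa [sub_sub, sub_eq_zero] at this
  -- Since `[a³, b] = 0`, one has `a² h = -2 a²`.
  have haah (v : V) : a (a (h v)) = -(2 : k) • a (a v) := by
    have h1 := hcube (b v)
    simp only [hab', map_add, hha', map_smul, hcube, map_zero, zero_add] at h1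
    have h6 : (3 : k) • (a (a (h v)) + (2 : k) • a (a v)) = 0 := by
      rw [← h1]; module
    rw [neg_smul]
    exact eq_neg_of_add_eq_zero_left ((smul_eq_zero_iff_right (by norm_num)).mp h6)
  -- The hypothesis `hax` says `a² x = 0`, because `a² b a = 2 a²`.
  have haax : a (a x) = 0 := by
    simp only [hab', map_add, hha', map_smul, hcube, map_zero, zero_add, haah] at hax
    have h2 : (2 : k) • a (a x) = 0 := by rw [← hax]; module
    exact (smul_eq_zero_iff_right (by norm_num)).mp h2
  have hhhx : h (h (a x)) = 0 := by simpa [hab' (a x), haax] using hhx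
  -- On `a x` the operator `h` satisfies both `h² = 0` and `(h - 1) (h - 2) = 0`.
  have hquad : (4 : k) • a x = (6 : k) • h (a x) := by
    have h1 : a (a (b x)) = (2 : k) • h (a x) - (2 : k) • a x := by
      simp only [hab', map_add, haax, hha', map_zero]; module
    have h2 : h (a (a (b x))) = (2 : k) • a (a (b x)) := by
      simp only [hha', map_add, map_smul, haah]; module
    rw [h1] at h2
    simp only [map_sub, map_smul, hhhx] at h2
    rw [← sub_eq_zero] at h2 ⊢
    rw [← h2]; module
  have hhax : h (a x) = 0 := by
    have h1 := congrArg h hquad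
    simp only [map_smul, hhhx, smul_zero] at h1
    exact (smul_eq_zero_iff_right (by norm_num)).mp h1
  rw [hhax, smul_zero] at hquad
  exact (smul_eq_zero_iff_right (by norm_num)).mp hquad

end Ring

/-! ### The derived bracket -/

section Lie

variable {k : Type*} {g : Type*} [Field k] [LieRing g] [LieAlgebra k g] {e : g}

theorem lie_lie_lie_eq_zero (he : LieAlgebra.ad k g e ^ 3 = 0) (x : g) : ⁅e, ⁅e, ⁅e, x⁆⁆⁆ = 0 := by
  simpa [pow_succ] using LinearMap.congr_fun he x

theorem ad_lie (x y : g) : LieAlgebra.ad k g ⁅x, y⁆ =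
    LieAlgebra.ad k g x * LieAlgebra.ad k g y - LieAlgebra.ad k g y * LieAlgebra.ad k g x := by
  ext z
  simp

theorem ad_eq_zero_of_mem_center {z : g} (hz : z ∈ LieAlgebra.center k g) :
    LieAlgebra.ad k g z = 0 := by
  ext y
  rw [LieAlgebra.ad_apply, ← lie_skew, (LieModule.mem_maxTrivSubmodule k g g _).mp hz y]
  simp

/-- The Leibniz rule for the square of the derivation `ad e`. -/
theorem lie_lie_lie_leibniz (x y : g) :
    ⁅e, ⁅e, ⁅x, y⁆⁆⁆ = ⁅⁅e, ⁅e, x⁆⁆, y⁆ + (2 : k) • ⁅⁅e, x⁆, ⁅e, y⁆⁆ + ⁅x, ⁅e, ⁅e, y⁆⁆⁆ := by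
  rw [leibniz_lie e x y, lie_add, leibniz_lie e ⁅e, x⁆ y, leibniz_lie e x ⁅e, y⁆]
  module

theorem derivedOperation_bracketMap_apply (x y : g) :
    derivedOperation (bracketMap k g) (LieAlgebra.ad k g e ^ 2) x y =
      (2 : k) • ⁅⁅e, x⁆, ⁅e, y⁆⁆ := by
  simp only [derivedOperation, bracketMap, LinearMap.mk₂_apply, pow_two, Module.End.mul_apply,
    LieAlgebra.ad_apply]
  rw [lie_lie_lie_leibniz (k := k)]
  abel

variable [CharZero k]

/-- The element `3 ⁅e, ⁅⁅e, x⁆, ⁅e, y⁆⁆⁆` is the Leibniz expansion of `(ad e)³ ⁅x, y⁆`. -/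
theorem lie_lie_lie_lie_eq_zero (he : LieAlgebra.ad k g e ^ 3 = 0) (x y : g) :
    ⁅e, ⁅⁅e, x⁆, ⁅e, y⁆⁆⁆ = 0 := by
  have h := lie_lie_lie_eq_zero he ⁅x, y⁆
  rw [lie_lie_lie_leibniz (k := k) x y, lie_add, lie_add, leibniz_lie e ⁅e, ⁅e, x⁆⁆,
    leibniz_lie e x, lie_lie_lie_eq_zero he, lie_lie_lie_eq_zero he, zero_lie, lie_zero, zero_add,
    add_zero, lie_smul] at h
  have h3 : (3 : k) • ⁅e, ⁅⁅e, x⁆, ⁅e, y⁆⁆⁆ = 0 := by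
    rw [← h, leibniz_lie e ⁅e, x⁆]
    module
  exact (smul_eq_zero_iff_right (by norm_num)).mp h3

theorem isLieBracket_derivedOperation (he : LieAlgebra.ad k g e ^ 3 = 0) :
    IsLieBracket (derivedOperation (bracketMap k g) (LieAlgebra.ad k g e ^ 2)) where
  alternating x := by simp [derivedOperation_bracketMap_apply]
  jacobi x y z := by
    simp only [derivedOperation_bracketMap_apply, lie_smul, lie_lie_lie_lie_eq_zero he, lie_zero,
      smul_zero, add_zero]

end Lie

/-! ### Reductive Lie algebras -/

section Reductive

variable {k : Type*} {g : Type*} [Field k] [CharZero k] [LieRing g] [LieAlgebra k g]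
  {e : g}

/-- The composite `ad e ∘ ad z` is nilpotent, since `ad e` commutes with `[ad e, ad z]`. -/
theorem killingForm_eq_zero_of_lie_lie_mem_center (he : LieAlgebra.ad k g e ^ 3 = 0) {z : g}
    (hz : ⁅e, ⁅e, z⁆⁆ ∈ LieAlgebra.center k g) : killingForm k g e z = 0 := by
  rw [killingForm_apply_apply]
  refine (LinearMap.isNilpotent_trace_of_isNilpotent ?_).eq_zero
  refine isNilpotent_mul_of_commute_commutator (c := LieAlgebra.ad k g ⁅e, z⁆)
    (fun x hx => ?_) (fun x hx => ?_) (by rw [← he]; noncomm_ring) ?_ ?_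
  · refine (smul_eq_zero_iff_right (two_ne_zero (α := k))).mp ?_
    rw [← hx, ofNat_smul_eq_nsmul, nsmul_eq_mul, Nat.cast_ofNat]
  · refine (smul_eq_zero_iff_right (three_ne_zero (α := k))).mp ?_
    rw [← hx, ofNat_smul_eq_nsmul, nsmul_eq_mul, Nat.cast_ofNat]
  · rw [ad_lie, sub_self]
  · rw [← ad_lie, ad_eq_zero_of_mem_center hz]

variable [FiniteDimensional k g]

/-- A consequence of Cartan's criterion: the kernel of the Killing form is a solvable ideal. -/
theorem mem_center_of_killingForm_eq_zero (hred : LieAlgebra.HasCentralRadical k g) {x : g}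
    (hx : ∀ y, killingForm k g y x = 0) : x ∈ LieAlgebra.center k g := by
  rw [← hred.radical_eq_center]
  exact LieAlgebra.killingCompl_top_le_radical k g
    ((LieIdeal.mem_killingCompl k g ⊤).mpr fun y _ => hx y)

/-- Up to the centre, `e` lies in the image of `(ad e)²`. -/
theorem exists_sub_lie_lie_mem_center (hred : LieAlgebra.HasCentralRadical k g)
    (he : LieAlgebra.ad k g e ^ 3 = 0) : ∃ f : g, e - ⁅e, ⁅e, f⁆⁆ ∈ LieAlgebra.center k g := by
  -- The adjoint operator of `(ad e)²` with respect to the Killing form is again `(ad e)²`.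
  let S : g →ₗ[k] Module.Dual k g := (killingForm k g).flip ∘ₗ (LieAlgebra.ad k g e ^ 2)
  have hS (z y : g) : S z y = killingForm k g y ⁅e, ⁅e, z⁆⁆ := by
    simp [S, pow_two]
  have hmem : killingForm k g e ∈ LinearMap.range S.dualMap := by
    rw [LinearMap.range_dualMap_eq_dualAnnihilator_ker, Submodule.mem_dualAnnihilator]
    intro z hz
    refine killingForm_eq_zero_of_lie_lie_mem_center he
      (mem_center_of_killingForm_eq_zero hred fun y => ?_)
    rw [← hS, LinearMap.mem_ker.mp hz, LinearMap.zero_apply]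
  obtain ⟨φ, hφ⟩ := hmem
  obtain ⟨f, rfl⟩ := (Module.evalEquiv k g).surjective φ
  refine ⟨f, mem_center_of_killingForm_eq_zero hred fun y => ?_⟩
  have hy : S y f = killingForm k g e y := by rw [← hφ]; rfl
  rw [LieModule.traceForm_comm, map_sub, LinearMap.sub_apply, ← hy, hS,
    LieModule.traceForm_apply_lie_apply', LieModule.traceForm_apply_lie_apply', neg_neg, sub_self]

/-- Some linear form `ξ` makes `(u, v) ↦ ξ ⁅u, v⁆` non-degenerate on the image of `ad e`. -/
theorem exists_dual_forall_lie_eq_zero (hred : LieAlgebra.HasCentralRadical k g)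
    (he : LieAlgebra.ad k g e ^ 3 = 0) :
    ∃ ξ : Module.Dual k g, ∀ x : g, (∀ y : g, ξ ⁅⁅e, x⁆, ⁅e, y⁆⁆ = 0) → ⁅e, x⁆ = 0 := by
  obtain ⟨f, hf⟩ := exists_sub_lie_lie_mem_center hred he
  refine ⟨killingForm k g f, fun x hx => ?_⟩
  have hcentral (y : g) : ⁅y, ⁅e, ⁅f, ⁅e, x⁆⁆⁆⁆ = 0 := by
    refine (LieModule.mem_maxTrivSubmodule k g g _).mp
      (mem_center_of_killingForm_eq_zero hred fun y => ?_) y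
    have := hx y
    rw [← LieModule.traceForm_apply_lie_apply, ← LieModule.traceForm_apply_lie_apply] at this
    rw [LieModule.traceForm_comm, ← lie_skew, map_neg, LinearMap.neg_apply, this, neg_zero]
  have had : LieAlgebra.ad k g e = LieAlgebra.ad k g ⁅e, ⁅e, f⁆⁆ := by
    rw [← sub_eq_zero, ← map_sub, ad_eq_zero_of_mem_center hf]
  -- The normalisation `b = -2 ad f` makes `[h, a] = 2 a`.
  refine apply_eq_zero_of_commutator_eq_two_smul (a := LieAlgebra.ad k g e) (x := x)
    (b := (-2 : k) • LieAlgebra.ad k g f) (h := (-2 : k) • LieAlgebra.ad k g ⁅e, f⁆)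
    (by rw [← he]; noncomm_ring) ?_ ?_ ?_ ?_
  · rw [ad_lie, mul_smul_comm, smul_mul_assoc]; module
  · have h1 : LieAlgebra.ad k g e = LieAlgebra.ad k g e * LieAlgebra.ad k g ⁅e, f⁆ -
        LieAlgebra.ad k g ⁅e, f⁆ * LieAlgebra.ad k g e := by
      rw [← ad_lie, ← had]
    rw [mul_smul_comm, smul_mul_assoc]
    nth_rw 3 [h1]
    module
  · simp [hcentral]
  · simp [hcentral]

end Reductive

end DerivedLie

theorem theorem6p5 {k : Type*} [Field k] [CharZero k]
    {g : Type*} [LieRing g] [LieAlgebra k g] [FiniteDimensional k g]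
    (hred : LieAlgebra.HasCentralRadical k g)
    (e : g) (he : LieAlgebra.ad k g e ^ 3 = 0)
    (D : Module.End k g) (hD : D = LieAlgebra.ad k g e ^ 2) :
    ∃ h : DerivedLie.IsLieBracket
        (DerivedLie.derivedOperation (DerivedLie.bracketMap k g) D),
      DerivedLie.index k (DerivedLie.WithBracket h) =
          Module.finrank k (DerivedLie.centraliser k g e) ∧
      (LieAlgebra.center k (DerivedLie.WithBracket h)).toSubmodule =
          (DerivedLie.centraliser k g e).map
            (DerivedLie.WithBracket.of h : g →ₗ[k] DerivedLie.WithBracket h) ∧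
      Module.finrank k (LieAlgebra.center k (DerivedLie.WithBracket h)) =
          DerivedLie.index k (DerivedLie.WithBracket h) := by
  subst hD
  have h := DerivedLie.isLieBracket_derivedOperation he
  refine ⟨h, ?_⟩
  let W := DerivedLie.WithBracket h
  let ι : g ≃ₗ[k] W := DerivedLie.WithBracket.of h
  have : FiniteDimensional k W := ι.finiteDimensional
  have hbracket (x y : g) : ⁅ι x, ι y⁆ = ι ((2 : k) • ⁅⁅e, x⁆, ⁅e, y⁆⁆) := by
    rw [← DerivedLie.derivedOperation_bracketMap_apply]
    exact DerivedLie.WithBracket.lie_of h x y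
  have hcentraliser (x : g) : x ∈ DerivedLie.centraliser k g e ↔ ⁅e, x⁆ = 0 := by
    rw [← lie_skew, neg_eq_zero]; rfl
  have hstab (ξ : Module.Dual k W) (x : W) :
      x ∈ DerivedLie.coadjointStabiliser k W ξ ↔ ∀ y : W, ξ ⁅x, y⁆ = 0 := by
    change ⁅x, ξ⁆ = 0 ↔ _
    simp [LinearMap.ext_iff]
  have hcenter_le (ξ : Module.Dual k W) :
      (LieAlgebra.center k W).toSubmodule ≤ DerivedLie.coadjointStabiliser k W ξ := by
    intro x hx
    refine (hstab ξ x).mpr fun y => ?_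
    rw [← lie_skew, (LieModule.mem_maxTrivSubmodule k W W x).mp hx y, neg_zero, map_zero]
  have hle_center : (DerivedLie.centraliser k g e).map (ι : g →ₗ[k] W) ≤
      (LieAlgebra.center k W).toSubmodule := by
    rintro _ ⟨x, hx, rfl⟩
    refine (LieModule.mem_maxTrivSubmodule k W W _).mpr fun y => ?_
    obtain ⟨y, rfl⟩ := ι.surjective y
    change ⁅ι y, ι x⁆ = 0
    rw [hbracket, (hcentraliser x).mp hx, lie_zero, smul_zero, map_zero]
  obtain ⟨ξ, hξ⟩ := DerivedLie.exists_dual_forall_lie_eq_zero hred he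
  let ξ' : Module.Dual k W := ξ ∘ₗ (ι.symm : W →ₗ[k] g)
  have hstab_le : DerivedLie.coadjointStabiliser k W ξ' ≤
      (DerivedLie.centraliser k g e).map (ι : g →ₗ[k] W) := by
    intro x hx
    obtain ⟨x, rfl⟩ := ι.surjective x
    refine ⟨x, (hcentraliser x).mpr (hξ x fun y => ?_), rfl⟩
    have := (hstab ξ' _).mp hx (ι y)
    rw [hbracket] at this
    simpa [ξ'] using this
  have hcenter : (LieAlgebra.center k W).toSubmodule =
      (DerivedLie.centraliser k g e).map (ι : g →ₗ[k] W) :=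
    le_antisymm ((hcenter_le ξ').trans hstab_le) hle_center
  have hfinrank : Module.finrank k (LieAlgebra.center k W) =
      Module.finrank k (DerivedLie.centraliser k g e) := by
    change Module.finrank k (LieAlgebra.center k W).toSubmodule = _
    rw [hcenter, LinearEquiv.finrank_map_eq]
  have hindex : DerivedLie.index k W = Module.finrank k (LieAlgebra.center k W) := by
    refine le_antisymm ?_ (le_ciInf fun ξ => Submodule.finrank_mono (hcenter_le ξ))
    exact (ciInf_le (OrderBot.bddBelow _) ξ').trans
      (Submodule.finrank_mono (hstab_le.trans hle_center))
  exact ⟨hindex.trans hfinrank, hcenter, hindex.symm⟩
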